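/- Let $\mathbb N=\{0,1,2,\dots\}$, $\mathbb P_+=\{1,2,\dots\}$, and let $m=(m_0,m_1,\dots)$ be a bounded sequence of integers $m_k\ge 2$. Let $G_m=\prod_{k}\mathbb Z/m_k\mathbb Z$ with its normalized Haar measure $\mu$ (the product of the uniform measures). Put $M_0=1$, $M_{k+1}=m_kM_k$, and write $n=\sum_j n_jM_j$ with $0\le n_j<m_j$. Let $r_k(x)=\exp(2\pi i x_k/m_k)$ and let $\psi_n=\prod_k r_k^{n_k}$ $(n\in\mathbb N)$ be the Vilenkin system. Let $\mathcal F_n$ be the $\sigma$-algebra generated by the sets $I_n(x)=\{y\in G_m: y_0=x_0,\dots,y_{n-1}=x_{n-1}\}$, $x\in G_m$. For a martingale $f=(f^{(n)})_{n\in\mathbb N}$ with respect to $(\mathcal F_n)$ put $$\|f\|_{H_p}=\Big(\int_{G_m}\sup_n|f^{(n)}|^p\,d\mu\Big)^{1/p},\quad \widehat f(i)=\lim_{k\to\infty}\int_{G_m} f^{(k)}\overline{\psi_i}\,d\mu,\quad S_nf=\sum_{k=0}^{n-1}\widehat f(k)\psi_k,\quad \sigma_nf=\frac1n\sum_{k=1}^nS_kf,$$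 write $f\in H_p$ if $\|f\|_{H_p}<\infty$, and let $\|g\|_{L_{p,\infty}}^p=\sup_{\lambda>0}\lambda^p\mu\{|g|>\lambda\}$. Theorem 2. Let $0<p<1/2$ and let $\Phi:\mathbb P_+\to[1,\infty)$ be a nondecreasing function with $\Phi(n)\to\infty$ and $$\limsup_{n\to\infty}\frac{n^{2-2p}}{\Phi(n)}=\infty .$$ Then there exists a martingale $f\in H_p$ such that $$\sum_{k=1}^\infty\frac{\|\sigma_kf\|_{L_{p,\infty}}^p}{\Phi(k)}=\infty .$$ -/

import Mathlib

namespace Vilenkin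

open MeasureTheory Filter Topology

/-- The Vilenkin group `G_m`: the complete direct product of the groups `ℤ / m_k ℤ`. -/
abbrev G (m : ℕ → ℕ) : Type := ∀ k : ℕ, ZMod (m k)

/-- The Haar probability measure of `G_m`: the product of the measures on `ℤ / m_k ℤ`
which give mass `1 / m_k` to each point. -/
noncomputable def haar (m : ℕ → ℕ) : Measure (G m) :=
  Measure.infinitePi fun k : ℕ => ((m k : ENNReal)⁻¹ • (Measure.count : Measure (ZMod (m k))))

/-- Each factor measure is a probability measure, so that the product measure makes sense. -/
theorem isProbabilityMeasure_factor (m : ℕ → ℕ) (hm : ∀ k, 2 ≤ m k) (k : ℕ) :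
    IsProbabilityMeasure ((m k : ENNReal)⁻¹ • (Measure.count : Measure (ZMod (m k)))) := by
  have := hm k
  have : NeZero (m k) := ⟨by omega⟩
  constructor
  simp only [Measure.smul_apply, smul_eq_mul]
  rw [Measure.count_apply MeasurableSet.univ]
  simp [Set.encard_univ, ENat.card_eq_coe_fintype_card, ZMod.card]
  refine ENNReal.inv_mul_cancel (by simp; omega) (by simp)

/-- The generalized powers: `M_0 = 1`, `M_{k+1} = m_k M_k`. -/
def M (m : ℕ → ℕ) : ℕ → ℕ
  | 0 => 1
  | k + 1 => m k * M m k

/-- The `j`-th digit `n_j` of `n` in the number system based on `m`. -/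
def digit (m : ℕ → ℕ) (n j : ℕ) : ℕ := n / M m j % m j

/-- The generalized Rademacher functions `r_k(x) = exp (2 π i x_k / m_k)`. -/
noncomputable def r (m : ℕ → ℕ) (k : ℕ) (x : G m) : ℂ :=
  Complex.exp (2 * Real.pi * Complex.I * ((x k).val : ℂ) / (m k : ℂ))

/-- The Vilenkin functions `ψ_n = ∏_k r_k ^ n_k`. When all `m_k ≥ 2`, the digits `n_k` with
`k > n` vanish (as `M_k ≥ 2 ^ k > n`), so the product over `k ≤ n` is the full product. -/
noncomputable def ψ (m : ℕ → ℕ) (n : ℕ) (x : G m) : ℂ :=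
  ∏ k ∈ Finset.range (n + 1), r m k x ^ digit m n k

/-- The interval `I_n(x)` of all `y` that share the first `n` coordinates of `x`. -/
def I (m : ℕ → ℕ) (n : ℕ) (x : G m) : Set (G m) := {y | ∀ k < n, y k = x k}

/-- The σ-algebra generated by the intervals `I_n(x)`, `x ∈ G_m`. -/
abbrev F (m : ℕ → ℕ) (n : ℕ) : MeasurableSpace (G m) :=
  MeasurableSpace.generateFrom {s | ∃ x : G m, s = I m n x}

/-- The σ-algebra generated by the intervals of rank `n` is the one of the first `n`
coordinates. -/
theorem F_eq_comap (m : ℕ → ℕ) (n : ℕ) :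
    F m n = MeasurableSpace.comap (fun (x : G m) (k : Fin n) => x k) ⊤ := by
  have hcount : ∀ a : ℕ, Countable (ZMod a) := by
    intro a
    cases a with
    | zero => exact inferInstanceAs (Countable ℤ)
    | succ a => exact inferInstanceAs (Countable (Fin (a + 1)))
  apply le_antisymm
  · refine MeasurableSpace.generateFrom_le ?_
    rintro s ⟨x, rfl⟩
    refine ⟨{fun k : Fin n => x k}, trivial, ?_⟩
    ext y
    simp only [I, Set.mem_preimage, Set.mem_singleton_iff, Set.mem_ofPred_eq, funext_iff]
    exact ⟨fun h k hk => h ⟨k, hk⟩, fun h k => h k k.2⟩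
  · rintro s ⟨T, -, rfl⟩
    have : (fun (x : G m) (k : Fin n) => x k) ⁻¹' T
        = ⋃ t ∈ T, (fun (x : G m) (k : Fin n) => x k) ⁻¹' {t} := by
      ext x; simp
    rw [this]
    refine MeasurableSet.biUnion T.to_countable fun t _ => ?_
    refine MeasurableSpace.measurableSet_generateFrom
      ⟨fun k => if h : k < n then t ⟨k, h⟩ else 0, ?_⟩
    ext y
    simp only [I, Set.mem_preimage, Set.mem_singleton_iff, Set.mem_ofPred_eq, funext_iff]
    constructor
    · intro h k hk
      rw [dif_pos hk]
      exact h ⟨k, hk⟩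
    · intro h k
      rw [h k k.2, dif_pos k.2]

/-- The filtration `(F_n)` of the Vilenkin group. -/
def filtration (m : ℕ → ℕ) : Filtration ℕ (MeasurableSpace.pi : MeasurableSpace (G m)) where
  seq := F m
  mono' := by
    intro a b hab
    rw [F_eq_comap, F_eq_comap]
    have h : (fun (x : G m) (k : Fin a) => x k)
        = (fun (z : ∀ k : Fin b, ZMod (m k)) (k : Fin a) => z ⟨k, k.2.trans_le hab⟩)
          ∘ (fun (x : G m) (k : Fin b) => x k) := rfl
    rw [h, ← MeasurableSpace.comap_comp]
    exact MeasurableSpace.comap_mono le_top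
  le' := by
    intro n
    refine MeasurableSpace.generateFrom_le ?_
    rintro s ⟨x, rfl⟩
    have : I m n x = ⋂ k ∈ Set.Iio n, (fun y : G m => y k) ⁻¹' {x k} := by
      ext y; simp [I]
    rw [this]
    exact MeasurableSet.biInter (Set.to_countable _) fun k _ =>
      measurable_pi_apply k (measurableSet_singleton _)

/-- A martingale `f = (f^(n))` with respect to `(F_n)` and the Haar measure. -/
def IsMartingale (m : ℕ → ℕ) (f : ℕ → G m → ℂ) : Prop :=
  Martingale f (filtration m) (haar m)

/-- The maximal function `f^* = sup_n |f^(n)|`, with values in `[0, ∞]`. -/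
noncomputable def maximal {m : ℕ → ℕ} (f : ℕ → G m → ℂ) (x : G m) : ENNReal :=
  ⨆ n, ‖f n x‖ₑ

/-- `‖f‖_{H_p} = ‖f^*‖_p = (∫ (f^*)^p dμ)^(1/p)`, with values in `[0, ∞]`. -/
noncomputable def hardyNorm {m : ℕ → ℕ} (p : ℝ) (f : ℕ → G m → ℂ) : ENNReal :=
  (∫⁻ x, maximal f x ^ p ∂haar m) ^ (1 / p)

/-- The martingale Hardy space `H_p`. -/
def MemHardy {m : ℕ → ℕ} (p : ℝ) (f : ℕ → G m → ℂ) : Prop :=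
  IsMartingale m f ∧ hardyNorm p f < ⊤

/-- The quasi-norm of weak `L_p`: `‖g‖_{L_{p,∞}}^p = sup_{t > 0} t^p μ {|g| > t}`. -/
noncomputable def weakNorm {m : ℕ → ℕ} (p : ℝ) (g : G m → ℂ) : ENNReal :=
  (⨆ (t : ℝ) (_ : 0 < t), ENNReal.ofReal (t ^ p) * haar m {x | t < ‖g x‖}) ^ (1 / p)

/-- The Vilenkin-Fourier coefficients of a martingale,
`f^(i) = lim_k ∫ f^(k) conj ψ_i dμ`. -/
noncomputable def coeff {m : ℕ → ℕ} (f : ℕ → G m → ℂ) (i : ℕ) : ℂ :=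
  limUnder atTop fun k : ℕ => ∫ x, f k x * (starRingEnd ℂ) (ψ m i x) ∂haar m

/-- The sequence in the definition of the coefficients is eventually constant for every
martingale, so that its limit exists. -/
theorem exists_coeff_const (m : ℕ → ℕ) (hm : ∀ k, 2 ≤ m k)
    (f : ℕ → G m → ℂ) (hf : IsMartingale m f) (i : ℕ) :
   ∃ c, ∀ k, i < k → ∫ x, f k x * (starRingEnd ℂ) (ψ m i x) ∂haar m = c := by
  have := isProbabilityMeasure_factor m hm
  have : IsProbabilityMeasure (haar m) := by unfold haar; infer_instance
  refine ⟨∫ x, f (i+1) x * (starRingEnd ℂ) (ψ m i x) ∂haar m, fun k hk => ?_⟩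
  have hψ : Measurable[F m (i+1)] fun x => (starRingEnd ℂ) (ψ m i x) := by
    rw [F_eq_comap]
    have : (fun x : G m => (starRingEnd ℂ) (ψ m i x)) = (fun z : (∀ k : Fin (i+1), ZMod (m k)) =>
       (starRingEnd ℂ) (∏ k : Fin (i+1), Complex.exp (2 * Real.pi * Complex.I * ((z k).val : ℂ) / (m k : ℂ)) ^ digit m i k)) ∘ (fun (x : G m) (k : Fin (i+1)) => x k) := by
      ext x; simp [ψ, r, Finset.prod_range]
    rw [this]
    exact (@measurable_from_top _ _ _ _).comp (comap_measurable _)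
  have hb : ∀ x, ‖(starRingEnd ℂ) (ψ m i x)‖ ≤ 1 := by
    intro x
    rw [RCLike.norm_conj, ψ, norm_prod]
    refine Finset.prod_le_one (fun _ _ => norm_nonneg _) fun k _ => ?_
    rw [norm_pow]
    refine pow_le_one₀ (norm_nonneg _) (le_of_eq ?_)
    have : r m k x = Complex.exp ((2 * Real.pi * (x k).val / m k : ℝ) * Complex.I) := by
      simp [r]; congr 1; ring
    rw [this, Complex.norm_exp_ofReal_mul_I]
  have hi : ∀ j, Integrable (fun x => f j x * (starRingEnd ℂ) (ψ m i x)) (haar m) := fun j =>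
    (hf.integrable j).mul_bdd (c := 1) ((hψ.mono ((filtration m).le _) le_rfl).aestronglyMeasurable) (.of_forall hb)
  have h1 := condExp_bilin_of_stronglyMeasurable_right (m := F m (i+1)) (ContinuousLinearMap.mul ℝ ℂ) hψ.stronglyMeasurable (hi k) (hf.integrable k)
  have h2 := hf.2 (i+1) k hk
  rw [← integral_condExp ((filtration m).le (i+1))]
  refine integral_congr_ae ?_
  filter_upwards [h1, h2] with x h1 h2
  have h1' : (haar m)[fun x => f k x * (starRingEnd ℂ) (ψ m i x)|F m (i+1)] x = (haar m)[f k|F m (i+1)] x * (starRingEnd ℂ) (ψ m i x) := h1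
  have h2' : (haar m)[f k|F m (i+1)] x = f (i+1) x := h2
  rw [← h2']; exact h1'

/-- The partial sums `S_n f = ∑_{k < n} f^(k) ψ_k`. -/
noncomputable def partialSum {m : ℕ → ℕ} (f : ℕ → G m → ℂ) (n : ℕ) (x : G m) : ℂ :=
  ∑ k ∈ Finset.range n, coeff f k * ψ m k x

/-- The Fejér means `σ_n f = (1 / n) ∑_{k = 1}^n S_k f`. -/
noncomputable def fejer {m : ℕ → ℕ} (f : ℕ → G m → ℂ) (n : ℕ) (x : G m) : ℂ :=
  (1 / (n : ℂ)) * ∑ k ∈ Finset.Icc 1 n, partialSum f k x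

end Vilenkin

namespace Vilenkin

open MeasureTheory Filter Topology ProbabilityTheory

/-! The martingale is a lacunary sum of `a_k r_k` restricted to `I_k(0)`, with `a_k = (w_k
M_k)^(1/p)`. Since `I_k(0)` has measure `1 / M_k` and `p`-th powers are subadditive for `p ≤ 1`, the
maximal function has `∫ (f^*)^p ≤ ∑ w_k`; so every summable `w` gives an element of `H_p`
(`memHardy_bumpSeries`). All Fourier coefficients with index in `[M_k, 2 M_k)` equal `a_k / M_k`
(`coeff_bumpSeries`). The second difference of `n σ_n f` is one Fourier term, of constant modulus
because `|ψ_i| = 1`. Hence at every point one of three consecutive Fejér means has size at least a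
constant times `a_k / M_k^2`, and their weak norms, to the power `p`, add up to a constant times
`w_k M_k^(1 - 2p)` (`le_sum_three_weakNorm`). Adding over the `M_k` indices of the block gives a
contribution of order `w_k M_k^(2 - 2p) / Φ(2 M_k)` to the series. The limsup hypothesis, moved to
the numbers `2 M_k` by boundedness of `m`, allows a summable `w` that keeps this contribution
bounded below for infinitely many `k`. The tails of the series then do not tend to zero. -/

theorem isProbabilityMeasure_haar {m : ℕ → ℕ} (hm : ∀ k, 2 ≤ m k) :
    IsProbabilityMeasure (haar m) := by
  have := isProbabilityMeasure_factor m hm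
  unfold haar
  infer_instance

/-! ### Growth of `M_k`, measurability, and the characters `r_k`, `ψ_n`. -/

theorem M_pos {m : ℕ → ℕ} (hm : ∀ k, 2 ≤ m k) (k : ℕ) : 0 < M m k := by
  induction k with
  | zero => simp [M]
  | succ k ih => exact Nat.mul_pos (by have := hm k; omega) ih

theorem two_mul_M_le {m : ℕ → ℕ} (hm : ∀ k, 2 ≤ m k) (k : ℕ) : 2 * M m k ≤ M m (k + 1) :=
  Nat.mul_le_mul_right _ (hm k)

theorem M_mono {m : ℕ → ℕ} (hm : ∀ k, 2 ≤ m k) : Monotone (M m) :=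
  monotone_nat_of_le_succ fun k => by have := two_mul_M_le hm k; omega

theorem lt_M {m : ℕ → ℕ} (hm : ∀ k, 2 ≤ m k) (k : ℕ) : k < M m k := by
  induction k with
  | zero => simp [M]
  | succ k ih => have := two_mul_M_le hm k; omega

/-- A function that depends on the first `n` coordinates only is measurable for the σ-algebra
of the intervals of rank `n`. -/
theorem stronglyMeasurable_of_agree {m : ℕ → ℕ} {n : ℕ} {g : G m → ℂ}
    (hg : ∀ x y : G m, (∀ k < n, x k = y k) → g x = g y) : StronglyMeasurable[F m n] g := by
  have h : g = (fun z : (∀ k : Fin n, ZMod (m k)) =>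
      g fun k => if h : k < n then z ⟨k, h⟩ else 0) ∘ fun (x : G m) (k : Fin n) => x k := by
    ext x
    refine hg _ _ fun k hk => ?_
    simp [hk]
  rw [F_eq_comap, h]
  exact ((@measurable_from_top _ _ _ _).comp (comap_measurable _)).stronglyMeasurable

theorem norm_r (m : ℕ → ℕ) (k : ℕ) (x : G m) : ‖r m k x‖ = 1 := by
  have : r m k x = Complex.exp ((2 * Real.pi * (x k).val / m k : ℝ) * Complex.I) := by
    simp [r]; congr 1; ring
  rw [this, Complex.norm_exp_ofReal_mul_I]

theorem norm_ψ (m : ℕ → ℕ) (n : ℕ) (x : G m) : ‖ψ m n x‖ = 1 := by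
  simp [ψ, norm_prod, norm_r]

theorem r_congr {m : ℕ → ℕ} {k : ℕ} {x y : G m} (h : x k = y k) : r m k x = r m k y := by
  simp [r, h]

theorem stronglyMeasurable_r (m : ℕ → ℕ) (k : ℕ) : StronglyMeasurable (r m k) :=
  (stronglyMeasurable_of_agree (n := k + 1) fun _ _ h => r_congr (h k (by omega))).mono
    ((filtration m).le (k + 1))

/-- `r_k` is the standard additive character of `ℤ / m_k ℤ` in the coordinate `x_k`. It is
nontrivial because `m_k ≥ 2`, so its values sum to zero. -/
theorem integral_r {m : ℕ → ℕ} (hm : ∀ k, 2 ≤ m k) (k : ℕ) : ∫ x, r m k x ∂haar m = 0 := by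
  have := isProbabilityMeasure_factor m hm
  have hne : NeZero (m k) := ⟨by have := hm k; omega⟩
  have hr : r m k = fun x : G m => ZMod.stdAddChar (x k) := by
    ext x
    rw [r, ZMod.stdAddChar_apply, ZMod.toCircle_apply]
  have hmp := measurePreserving_eval_infinitePi
    (fun k : ℕ => ((m k : ENNReal)⁻¹ • (Measure.count : Measure (ZMod (m k))))) k
  have hsum : ∑ a : ZMod (m k), (ZMod.stdAddChar a : ℂ) = 0 := by
    have : Fact (1 < m k) := ⟨hm k⟩
    refine AddChar.sum_eq_zero_of_ne_one fun h => ?_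
    have := ZMod.injective_stdAddChar (N := m k) (a₁ := 1) (a₂ := 0) (by simp [h])
    exact one_ne_zero this
  rw [hr]
  have hint := integral_map (μ := haar m) (φ := fun x : G m => x k) (measurable_pi_apply k).aemeasurable
    (f := fun a => (ZMod.stdAddChar a : ℂ)) Measurable.of_discrete.aestronglyMeasurable
  rw [← hint]
  have hmap : (haar m).map (fun x : G m => x k)
    = (m k : ENNReal)⁻¹ • (Measure.count : Measure (ZMod (m k))) := hmp.map_eq
  rw [hmap, integral_smul_measure, integral_count, hsum, smul_zero]

theorem indep_coordinate {m : ℕ → ℕ} (hm : ∀ k, 2 ≤ m k) (n : ℕ) :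
    Indep (MeasurableSpace.comap (fun x : G m => x n) inferInstance) (F m n) (haar m) := by
  have := isProbabilityMeasure_factor m hm
  have h := (iIndepFun_infinitePi (P := fun k : ℕ =>
    ((m k : ENNReal)⁻¹ • (Measure.count : Measure (ZMod (m k))))) (X := fun _ a => a)
    (fun _ => measurable_id)).indepFun_finset {n} (Finset.range n) (by simp)
    (fun k => measurable_pi_apply k)
  rw [IndepFun_iff_Indep] at h
  refine indep_of_indep_of_le_left (indep_of_indep_of_le_right h ?_) ?_
  · refine MeasurableSpace.generateFrom_le ?_
    rintro s ⟨x, rfl⟩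
    refine ⟨{fun k : Finset.range n => x k}, measurableSet_singleton _, ?_⟩
    ext y
    simp [I, funext_iff]
  · rintro s ⟨T, hT, rfl⟩
    exact ⟨{z : (i : ({n} : Finset ℕ)) → ZMod (m i) | z ⟨n, by simp⟩ ∈ T},
      measurable_pi_apply (X := fun i : ({n} : Finset ℕ) => ZMod (m i)) ⟨n, by simp⟩ hT, rfl⟩

theorem condExp_r {m : ℕ → ℕ} (hm : ∀ k, 2 ≤ m k) (n : ℕ) :
    (haar m)[r m n | F m n] =ᵐ[haar m] 0 := by
  have := isProbabilityMeasure_haar hm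
  have h : StronglyMeasurable[MeasurableSpace.comap (fun x : G m => x n) inferInstance]
      (r m n) := by
    have : r m n = (fun a : ZMod (m n) =>
      Complex.exp (2 * Real.pi * Complex.I * (a.val : ℂ) / (m n : ℂ))) ∘ fun x : G m => x n := rfl
    rw [this]
    exact (Measurable.of_discrete.comp (comap_measurable _)).stronglyMeasurable
  refine (condExp_indep_eq (measurable_pi_apply n).comap_le ((filtration m).le n) h
    (indep_coordinate hm n)).trans (.of_forall fun x => ?_)
  simp [integral_r hm]

theorem integrable_r {m : ℕ → ℕ} (hm : ∀ k, 2 ≤ m k) (n : ℕ) :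
    Integrable (r m n) (haar m) := by
  have := isProbabilityMeasure_haar hm
  exact .of_bound (stronglyMeasurable_r m n).aestronglyMeasurable 1
    (.of_forall fun x => (norm_r m n x).le)

theorem integrable_mul_r {m : ℕ → ℕ} (hm : ∀ k, 2 ≤ m k) {n : ℕ} {g : G m → ℂ}
    (hg : StronglyMeasurable[F m n] g) {C : ℝ} (hC : ∀ x, ‖g x‖ ≤ C) :
    Integrable (fun x => g x * r m n x) (haar m) :=
  (integrable_r hm n).bdd_mul (hg.mono ((filtration m).le n)).aestronglyMeasurable
    (.of_forall hC)

/-- The `F_n`-measurable factor pulls out, and `r_n` is independent of `F_n` with mean zero. Both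
the martingale property and the orthogonality relations below come from this. -/
theorem condExp_mul_r {m : ℕ → ℕ} (hm : ∀ k, 2 ≤ m k) {n : ℕ} {g : G m → ℂ}
    (hg : StronglyMeasurable[F m n] g) {C : ℝ} (hC : ∀ x, ‖g x‖ ≤ C) :
    (haar m)[fun x => g x * r m n x | F m n] =ᵐ[haar m] 0 := by
  have h1 := condExp_bilin_of_stronglyMeasurable_left (m := F m n) (ContinuousLinearMap.mul ℝ ℂ)
    hg (integrable_mul_r hm hg hC) (integrable_r hm n)
  filter_upwards [h1, condExp_r hm n] with x h1 h2
  refine h1.trans ?_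
  simp [h2]

theorem integral_mul_r {m : ℕ → ℕ} (hm : ∀ k, 2 ≤ m k) {n : ℕ} {g : G m → ℂ}
    (hg : StronglyMeasurable[F m n] g) {C : ℝ} (hC : ∀ x, ‖g x‖ ≤ C) :
    ∫ x, g x * r m n x ∂haar m = 0 := by
  have := isProbabilityMeasure_haar hm
  exact (integral_condExp ((filtration m).le n)).symm.trans
    ((integral_congr_ae (condExp_mul_r hm hg hC)).trans (by simp))

/-! ### The martingale built from bumps on `I_k(0)`. -/

theorem haar_I {m : ℕ → ℕ} (hm : ∀ k, 2 ≤ m k) (n : ℕ) (x : G m) :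
    haar m (I m n x) = (M m n : ENNReal)⁻¹ := by
  have := isProbabilityMeasure_factor m hm
  have h : I m n x = Set.pi (Finset.range n) fun k => {x k} := by
    ext y; simp [I, Set.mem_pi]
  rw [h, haar, Measure.infinitePi_pi _ fun k _ => measurableSet_singleton _]
  simp only [Measure.smul_apply, Measure.count_singleton, smul_eq_mul, mul_one]
  clear h
  induction n with
  | zero => simp [M]
  | succ n ih =>
    rw [Finset.prod_range_succ, ih, M, Nat.cast_mul, mul_comm,
      ENNReal.mul_inv (by simp) (by simp)]

/-- The function equal to `a` on the interval `I_n(0)` and to `0` elsewhere. -/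
noncomputable def bump (m : ℕ → ℕ) (n : ℕ) (a : ℝ) : G m → ℂ :=
  (I m n 0).indicator fun _ => (a : ℂ)

theorem I_congr {m : ℕ → ℕ} {n : ℕ} {x y z : G m} (h : ∀ k < n, x k = y k) :
    x ∈ I m n z ↔ y ∈ I m n z :=
  forall₂_congr fun k hk => by rw [h k hk]

theorem bump_congr {m : ℕ → ℕ} {n : ℕ} {a : ℝ} {x y : G m} (h : ∀ k < n, x k = y k) :
    bump m n a x = bump m n a y := by
  by_cases hx : x ∈ I m n 0
  · simp [bump, hx, (I_congr h).1 hx]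
  · simp [bump, hx, mt (I_congr h).2 hx]

theorem norm_bump_le (m : ℕ → ℕ) (n : ℕ) (a : ℝ) (x : G m) : ‖bump m n a x‖ ≤ |a| := by
  by_cases hx : x ∈ I m n 0 <;> simp [bump, hx]

/-- The martingale with differences `a_k r_k` on `I_k(0)`. -/
noncomputable def bumpSeries (m : ℕ → ℕ) (a : ℕ → ℝ) (n : ℕ) (x : G m) : ℂ :=
  ∑ k ∈ Finset.range n, bump m k (a k) x * r m k x

theorem isMartingale_bumpSeries {m : ℕ → ℕ} (hm : ∀ k, 2 ≤ m k) (a : ℕ → ℝ) :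
    IsMartingale m (bumpSeries m a) := by
  have := isProbabilityMeasure_haar hm
  have hmeas : ∀ n, StronglyMeasurable[F m n] (bump m n (a n)) := fun n =>
    stronglyMeasurable_of_agree fun _ _ => bump_congr
  refine martingale_of_condExp_sub_eq_zero_nat (fun n => ?_) (fun n => ?_) fun n => ?_
  · refine stronglyMeasurable_of_agree fun x y h => Finset.sum_congr rfl fun k hk => ?_
    rw [Finset.mem_range] at hk
    rw [r_congr (h k hk), bump_congr fun j hj => h j (hj.trans hk)]
  · exact integrable_finsetSum _ fun k _ => integrable_mul_r hm (hmeas k) (norm_bump_le m k (a k))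
  · have h : bumpSeries m a (n + 1) - bumpSeries m a n
        = fun x => bump m n (a n) x * r m n x := by
      ext x
      simp [bumpSeries, Finset.sum_range_succ]
    rw [h]
    exact condExp_mul_r hm (hmeas n) (norm_bump_le m n (a n))

/-! ### Fourier coefficients on the blocks `[M_n, 2 M_n)`. -/

theorem digit_eq_zero {m : ℕ → ℕ} (hm : ∀ k, 2 ≤ m k) {n i k : ℕ} (hi : i < 2 * M m n)
    (hk : n < k) : digit m i k = 0 := by
  have h1 := two_mul_M_le hm n
  have h2 := M_mono hm hk
  rw [digit, Nat.div_eq_of_lt (by simp only [Nat.succ_eq_add_one] at h2; omega), Nat.zero_mod]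

theorem digit_eq_one {m : ℕ → ℕ} (hm : ∀ k, 2 ≤ m k) {n i : ℕ} (hi : M m n ≤ i)
    (hi' : i < 2 * M m n) : digit m i n = 1 := by
  have : i / M m n = 1 := Nat.div_eq_of_lt_le (by omega) (by omega)
  rw [digit, this, Nat.mod_eq_of_lt (hm n)]

/-- `ψ_i = ψ' r_n` for `M_n ≤ i < 2 M_n`, where `ψ'` depends on the first `n` coordinates. -/
theorem ψ_eq_prod_mul_r {m : ℕ → ℕ} (hm : ∀ k, 2 ≤ m k) {n i : ℕ} (hi : M m n ≤ i)
    (hi' : i < 2 * M m n) (x : G m) :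
    ψ m i x = (∏ k ∈ Finset.range n, r m k x ^ digit m i k) * r m n x := by
  have h : Finset.range (n + 1) ⊆ Finset.range (i + 1) := by
    have := lt_M hm n
    exact Finset.range_subset_range.2 (by omega)
  rw [ψ, ← Finset.prod_subset h fun k _ hk => ?_, Finset.prod_range_succ,
    digit_eq_one hm hi hi', pow_one]
  rw [digit_eq_zero hm hi' (by simp at hk; omega), pow_zero]

/-- If `k ≠ n`, the character `r` of the larger index is multiplied by a function of earlier
coordinates only, so the integral vanishes. If `k = n`, the factors of `ψ_i` before `r_n` are `1` on
`I_n(0)` and `r_n` cancels its conjugate, leaving `a μ(I_n(0))`. -/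
theorem integral_bump_mul_r_mul_conj_ψ {m : ℕ → ℕ} (hm : ∀ k, 2 ≤ m k) {n i : ℕ}
    (hi : M m n ≤ i) (hi' : i < 2 * M m n) (k : ℕ) (a : ℝ) :
    ∫ x, bump m k a x * r m k x * (starRingEnd ℂ) (ψ m i x) ∂haar m
      = if k = n then (a / M m n : ℂ) else 0 := by
  rcases lt_trichotomy k n with hk | rfl | hk
  · rw [if_neg hk.ne]
    -- Conjugating the whole integrand makes `r_n` appear unconjugated, as `integral_mul_r` needs.
    have h : ∀ x : G m, bump m k a x * r m k x * (starRingEnd ℂ) (ψ m i x)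
        = (starRingEnd ℂ) (((starRingEnd ℂ) (bump m k a x * r m k x)
          * ∏ j ∈ Finset.range n, r m j x ^ digit m i j) * r m n x) := by
      intro x
      rw [ψ_eq_prod_mul_r hm hi hi']
      simp [mul_assoc]
    simp_rw [h]
    rw [integral_conj, integral_mul_r hm (C := |a|), map_zero]
    · refine stronglyMeasurable_of_agree fun x y hxy => ?_
      rw [r_congr (hxy k hk), bump_congr fun j hj => hxy j (hj.trans hk)]
      congr 1
      exact Finset.prod_congr rfl fun j hj => by rw [r_congr (hxy j (Finset.mem_range.1 hj))]
    · intro x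
      simpa [norm_prod, norm_r] using norm_bump_le m k a x
  · have h : ∀ x : G m, bump m k a x * r m k x * (starRingEnd ℂ) (ψ m i x) = bump m k a x := by
      intro x
      by_cases hx : x ∈ I m k 0
      · have h1 : ∏ j ∈ Finset.range k, r m j x ^ digit m i j = 1 := by
          refine Finset.prod_eq_one fun j hj => ?_
          have : x j = 0 := hx j (Finset.mem_range.1 hj)
          simp [r, this]
        rw [ψ_eq_prod_mul_r hm hi hi', h1, one_mul, mul_assoc, Complex.mul_conj,
          Complex.normSq_eq_norm_sq, norm_r]
        simp
      · simp [bump, hx]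
    have hmeas : MeasurableSet (I m k 0) := (filtration m).le k _
      (MeasurableSpace.measurableSet_generateFrom ⟨0, rfl⟩)
    simp_rw [h]
    rw [if_pos trivial, bump, integral_indicator_const _ hmeas, measureReal_def, haar_I hm]
    simp [div_eq_inv_mul]
  · rw [if_neg hk.ne']
    have h : ∀ x : G m, bump m k a x * r m k x * (starRingEnd ℂ) (ψ m i x)
        = bump m k a x * (starRingEnd ℂ) (ψ m i x) * r m k x := fun x => by ring
    simp_rw [h]
    refine integral_mul_r hm (C := |a|) (stronglyMeasurable_of_agree fun x y hxy => ?_) fun x => ?_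
    · rw [bump_congr hxy, ψ_eq_prod_mul_r hm hi hi', ψ_eq_prod_mul_r hm hi hi',
        r_congr (hxy n hk)]
      congr 3
      exact Finset.prod_congr rfl fun j hj => by
        rw [r_congr (hxy j ((Finset.mem_range.1 hj).trans hk))]
    · simpa [norm_ψ] using norm_bump_le m k a x

theorem coeff_bumpSeries {m : ℕ → ℕ} (hm : ∀ k, 2 ≤ m k) (a : ℕ → ℝ) {n i : ℕ}
    (hi : M m n ≤ i) (hi' : i < 2 * M m n) :
    coeff (bumpSeries m a) i = (a n / M m n : ℂ) := by
  have := isProbabilityMeasure_haar hm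
  refine Tendsto.limUnder_eq (tendsto_const_nhds.congr' ?_)
  -- Once `k > n`, the `k`-th partial sum contains the only difference that correlates with `ψ_i`.
  filter_upwards [eventually_gt_atTop n] with k hk
  have hint : ∀ j ∈ Finset.range k, Integrable
      (fun x => bump m j (a j) x * r m j x * (starRingEnd ℂ) (ψ m i x)) (haar m) := by
    intro j _
    have h : StronglyMeasurable[F m (i + 1)] fun x => (starRingEnd ℂ) (ψ m i x) :=
      stronglyMeasurable_of_agree fun x y hxy => congrArg _ <| Finset.prod_congr rfl fun l hl => by
        rw [r_congr (hxy l (Finset.mem_range.1 hl))]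
    refine (integrable_mul_r hm (stronglyMeasurable_of_agree fun _ _ => bump_congr)
      (norm_bump_le m j (a j))).mul_bdd (c := 1)
      (h.mono ((filtration m).le _)).aestronglyMeasurable (.of_forall fun x => ?_)
    simp [norm_ψ]
  simp_rw [bumpSeries, Finset.sum_mul]
  rw [integral_finsetSum _ hint]
  simp [integral_bump_mul_r_mul_conj_ψ hm hi hi', hk]

/-! ### The `H_p` bound. -/

theorem rpow_sum_le_sum_rpow {ι : Type*} (s : Finset ι) (u : ι → ENNReal) {p : ℝ} (hp : 0 < p)
    (hp1 : p ≤ 1) : (∑ i ∈ s, u i) ^ p ≤ ∑ i ∈ s, u i ^ p := by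
  classical
  induction s using Finset.induction_on with
  | empty => simp [hp]
  | insert i s hi ih =>
    rw [Finset.sum_insert hi, Finset.sum_insert hi]
    exact (ENNReal.rpow_add_le_add_rpow _ _ hp.le hp1).trans (by gcongr)

theorem maximal_bumpSeries_rpow_le {m : ℕ → ℕ} {p : ℝ} (hp : 0 < p) (hp1 : p ≤ 1) (a : ℕ → ℝ)
    (x : G m) :
    maximal (bumpSeries m a) x ^ p ≤ ∑' k, (I m k 0).indicator (fun _ => ‖a k‖ₑ ^ p) x := by
  rw [← ENNReal.le_rpow_inv_iff hp, maximal]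
  refine iSup_le fun n => ?_
  rw [ENNReal.le_rpow_inv_iff hp]
  calc ‖bumpSeries m a n x‖ₑ ^ p
      ≤ (∑ k ∈ Finset.range n, ‖bump m k (a k) x * r m k x‖ₑ) ^ p := by
        gcongr
        exact enorm_sum_le _ _
    _ ≤ ∑ k ∈ Finset.range n, ‖bump m k (a k) x * r m k x‖ₑ ^ p :=
        rpow_sum_le_sum_rpow _ _ hp hp1
    _ = ∑ k ∈ Finset.range n, (I m k 0).indicator (fun _ => ‖a k‖ₑ ^ p) x := by
        refine Finset.sum_congr rfl fun k _ => ?_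
        have hr : ‖r m k x‖ₑ = 1 := by rw [← ofReal_norm, norm_r, ENNReal.ofReal_one]
        rw [enorm_mul, hr, mul_one]
        by_cases hx : x ∈ I m k 0
        · simp [bump, hx, ← ofReal_norm]
        · simp [bump, hx, hp]
    _ ≤ _ := ENNReal.sum_le_tsum _

/-- The `p`-th powers `w k` of the `H_p`-norms of the differences may be prescribed. -/
theorem memHardy_bumpSeries {m : ℕ → ℕ} (hm : ∀ k, 2 ≤ m k) {p : ℝ} (hp : 0 < p) (hp1 : p ≤ 1)
    {w : ℕ → ℝ} (hw : ∀ k, 0 ≤ w k) (hsum : Summable w) :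
    MemHardy p (bumpSeries m fun k => (w k * M m k) ^ (1 / p)) := by
  refine ⟨isMartingale_bumpSeries hm _, ENNReal.rpow_lt_top_of_nonneg (by positivity) ?_⟩
  refine ((lintegral_mono fun x => maximal_bumpSeries_rpow_le hp hp1 _ x).trans_lt ?_).ne
  have hmeas : ∀ k, MeasurableSet (I m k 0) := fun k => (filtration m).le k _
    (MeasurableSpace.measurableSet_generateFrom ⟨0, rfl⟩)
  rw [lintegral_tsum fun k => (measurable_const.indicator (hmeas k)).aemeasurable]
  -- The exponent in `a_k` is chosen for this: `|a_k|^p μ(I_k(0)) = w_k M_k / M_k`.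
  have h : ∀ k, ∫⁻ x, (I m k 0).indicator
      (fun _ => ‖(w k * M m k) ^ (1 / p)‖ₑ ^ p) x ∂haar m = ENNReal.ofReal (w k) := by
    intro k
    have hM : (0 : ℝ) < M m k := by exact_mod_cast M_pos hm k
    rw [lintegral_indicator_const (hmeas k), haar_I hm,
      Real.enorm_eq_ofReal (Real.rpow_nonneg (mul_nonneg (hw k) hM.le) _),
      ENNReal.ofReal_rpow_of_nonneg (Real.rpow_nonneg (mul_nonneg (hw k) hM.le) _) hp.le,
      ← Real.rpow_mul (mul_nonneg (hw k) hM.le), one_div_mul_cancel hp.ne', Real.rpow_one,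
      ENNReal.ofReal_mul (hw k), ENNReal.ofReal_natCast, mul_assoc,
      ENNReal.mul_inv_cancel (by exact_mod_cast hM.ne') (by simp), mul_one]
  simp_rw [h]
  exact hsum.tsum_ofReal_lt_top

/-! ### Lower bounds for three consecutive Fejér means. -/

theorem le_weakNorm_rpow {m : ℕ → ℕ} {p : ℝ} (hp : 0 < p) (g : G m → ℂ) {t : ℝ} (ht : 0 < t) :
    ENNReal.ofReal (t ^ p) * haar m {x | t < ‖g x‖} ≤ weakNorm p g ^ p := by
  rw [weakNorm, ← ENNReal.rpow_mul, one_div_mul_cancel hp.ne', ENNReal.rpow_one]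
  exact le_iSup₂ (f := fun (t : ℝ) (_ : 0 < t) =>
    ENNReal.ofReal (t ^ p) * haar m {x | t < ‖g x‖}) t ht

theorem natCast_mul_fejer {m : ℕ → ℕ} (f : ℕ → G m → ℂ) {n : ℕ} (hn : n ≠ 0) (x : G m) :
    n * fejer f n x = ∑ k ∈ Finset.Icc 1 n, partialSum f k x := by
  have : (n : ℂ) ≠ 0 := by exact_mod_cast hn
  rw [fejer]
  field_simp

/-- The second difference of `n σ_n f` is a single term of the Fourier series. -/
theorem second_difference_fejer {m : ℕ → ℕ} (f : ℕ → G m → ℂ) (k : ℕ) (x : G m) :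
    ((k + 3 : ℕ) : ℂ) * fejer f (k + 3) x - 2 * (((k + 2 : ℕ) : ℂ) * fejer f (k + 2) x)
      + ((k + 1 : ℕ) : ℂ) * fejer f (k + 1) x = coeff f (k + 2) * ψ m (k + 2) x := by
  rw [natCast_mul_fejer f (by omega), natCast_mul_fejer f (by omega),
    natCast_mul_fejer f (by omega), Finset.sum_Icc_succ_top (by omega),
    Finset.sum_Icc_succ_top (by omega)]
  have h : partialSum f (k + 3) x = partialSum f (k + 2) x + coeff f (k + 2) * ψ m (k + 2) x :=
    Finset.sum_range_succ _ _
  linear_combination h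

/-- If all three means were at most `t`, the second difference, with weights `1, 2, 1`, would be at
most `4 N t`. The constant `8` leaves room for a strict contradiction. -/
theorem exists_lt_norm_fejer {m : ℕ → ℕ} (f : ℕ → G m → ℂ) {k N : ℕ} (hN : k + 3 ≤ N) {t : ℝ}
    (ht : 0 < t) (hc : 8 * N * t ≤ ‖coeff f (k + 2)‖) (x : G m) :
    t < ‖fejer f (k + 1) x‖ ∨ t < ‖fejer f (k + 2) x‖ ∨ t < ‖fejer f (k + 3) x‖ := by
  by_contra! h
  obtain ⟨h1, h2, h3⟩ := h
  have hb : ∀ n ≤ N, ‖fejer f n x‖ ≤ t → ‖(n : ℂ) * fejer f n x‖ ≤ N * t := by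
    intro n hn hle
    rw [norm_mul, Complex.norm_natCast]
    gcongr
  have e1 := hb _ (by omega) h1
  have e2 := hb _ (by omega) h2
  have e3 := hb _ hN h3
  have h := second_difference_fejer f k x
  have h' : ‖coeff f (k + 2)‖ = ‖coeff f (k + 2) * ψ m (k + 2) x‖ := by simp [norm_ψ]
  rw [h', ← h] at hc
  have hle := (norm_add_le _ _).trans (add_le_add_left (norm_sub_le
    (((k + 3 : ℕ) : ℂ) * fejer f (k + 3) x) (2 * (((k + 2 : ℕ) : ℂ) * fejer f (k + 2) x)))
    ‖((k + 1 : ℕ) : ℂ) * fejer f (k + 1) x‖)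
  rw [norm_mul 2, Complex.norm_ofNat] at hle
  have hpos : 0 < N * t := mul_pos (by exact_mod_cast (by omega : 0 < N)) ht
  linarith

/-- The three superlevel sets at height `t` cover the group, so their measures add up to at least
`1`. -/
theorem le_sum_three_weakNorm {m : ℕ → ℕ} (hm : ∀ k, 2 ≤ m k) {p : ℝ} (hp : 0 < p)
    (f : ℕ → G m → ℂ) {k N : ℕ} (hN : k + 3 ≤ N) {t : ℝ} (ht : 0 < t)
    (hc : 8 * N * t ≤ ‖coeff f (k + 2)‖) :
    ENNReal.ofReal (t ^ p) ≤ weakNorm p (fejer f (k + 1)) ^ p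
      + weakNorm p (fejer f (k + 2)) ^ p + weakNorm p (fejer f (k + 3)) ^ p := by
  have := isProbabilityMeasure_haar hm
  have hcover : (Set.univ : Set (G m)) ⊆ ({x | t < ‖fejer f (k + 1) x‖}
      ∪ {x | t < ‖fejer f (k + 2) x‖}) ∪ {x | t < ‖fejer f (k + 3) x‖} := by
    intro x _
    rcases exists_lt_norm_fejer f hN ht hc x with h | h | h
    · exact .inl (.inl h)
    · exact .inl (.inr h)
    · exact .inr h
  have hone := (measure_mono hcover).trans ((measure_union_le (μ := haar m) _ _).trans
    (add_le_add_left (measure_union_le _ _) _))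
  rw [measure_univ] at hone
  calc ENNReal.ofReal (t ^ p) = ENNReal.ofReal (t ^ p) * 1 := (mul_one _).symm
    _ ≤ _ := mul_le_mul_right hone _
    _ ≤ _ := by
      rw [mul_add, mul_add]
      gcongr <;> exact le_weakNorm_rpow hp _ ht

/-! ### Choice of the weights `w_k`. -/

/-- A nonnegative sequence that is not bounded above diverges against a summable weight. -/
theorem exists_summable_frequently_one_le_mul {g : ℕ → ℝ}
    (hg : ∀ C : ℝ, ∃ᶠ n in atTop, C ≤ g n) :
    ∃ w : ℕ → ℝ, (∀ n, 0 ≤ w n) ∧ Summable w ∧ ∃ᶠ n in atTop, 1 ≤ w n * g n := by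
  obtain ⟨φ, hφ, hle⟩ := extraction_forall_of_frequently fun k => hg (2 ^ k)
  -- The weight is `2^(-k)` at `φ k`, where `g` is at least `2^k`, and zero off the range of `φ`.
  refine ⟨Function.extend φ (fun k => (1 / 2 : ℝ) ^ k) 0, fun n => ?_, ?_, ?_⟩
  · by_cases h : ∃ k, φ k = n
    · obtain ⟨k, rfl⟩ := h
      rw [hφ.injective.extend_apply]
      positivity
    · rw [Function.extend_apply' _ _ _ h]
      rfl
  · refine (hφ.injective.summable_iff fun n hn => ?_).1 ?_
    · exact Function.extend_apply' _ _ _ hn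
    · exact summable_geometric_two.congr fun k => (hφ.injective.extend_apply _ _ k).symm
  · refine hφ.tendsto_atTop.frequently (Frequently.of_forall fun k => ?_)
    rw [hφ.injective.extend_apply]
    calc (1 : ℝ) = (1 / 2) ^ k * 2 ^ k := by rw [← mul_pow]; norm_num
      _ ≤ _ := by gcongr; exact hle k

/-- The growth hypothesis passes from all integers to the numbers `2 M_k`. -/
theorem frequently_le_M_rpow_div {m : ℕ → ℕ} (hm : ∀ k, 2 ≤ m k)
    (hm_bdd : BddAbove (Set.range m)) {q : ℝ} (hq : 0 ≤ q) {Φ : ℕ → ℝ} (hΦ : ∀ n, 0 < Φ n)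
    (hΦ_mono : ∀ a b, 0 < a → a ≤ b → Φ a ≤ Φ b)
    (hfreq : ∀ C : ℝ, ∃ᶠ n : ℕ in atTop, C ≤ (n : ℝ) ^ q / Φ n) (C : ℝ) :
    ∃ᶠ k in atTop, C ≤ (M m k : ℝ) ^ q / Φ (2 * M m k) := by
  obtain ⟨B, hB⟩ := hm_bdd
  have hmB : ∀ k, m k ≤ B := fun k => hB ⟨k, rfl⟩
  have hBpos : 0 < B := by have := hm 0; have := hmB 0; omega
  rw [frequently_atTop]
  intro K
  obtain ⟨n, hn, hCn⟩ := frequently_atTop.1 (hfreq ((2 * B : ℝ) ^ q * C)) (2 * M m K)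
  -- For the last `k` with `2 M_k ≤ n`, we have `n < 2 M_{k+1} ≤ 2 B M_k` and `Φ(2 M_k) ≤ Φ(n)`; the
  -- loss `(2B)^q` was put into the constant beforehand.
  let k := Nat.findGreatest (fun k => 2 * M m k ≤ n) n
  have hKn : K ≤ n := by have := lt_M hm K; omega
  have hk : 2 * M m k ≤ n := Nat.findGreatest_spec (P := fun k => 2 * M m k ≤ n) hKn hn
  have hKk : K ≤ k := Nat.le_findGreatest hKn hn
  have hk' : n < 2 * M m (k + 1) := by
    by_contra! h
    have h1 : k + 1 ≤ n := by have := lt_M hm (k + 1); omega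
    have := Nat.le_findGreatest (P := fun k => 2 * M m k ≤ n) h1 h
    omega
  refine ⟨k, hKk, ?_⟩
  have hMpos := M_pos hm k
  have hnM : n ≤ 2 * B * M m k := by
    have : M m (k + 1) ≤ B * M m k := Nat.mul_le_mul_right _ (hmB k)
    nlinarith
  have hpow : (n : ℝ) ^ q ≤ (2 * B : ℝ) ^ q * (M m k : ℝ) ^ q := by
    rw [← Real.mul_rpow (by positivity) (by positivity)]
    exact Real.rpow_le_rpow (by positivity) (by exact_mod_cast hnM) hq
  have hc : (0 : ℝ) < (2 * B : ℝ) ^ q := by positivity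
  refine le_of_mul_le_mul_left (hCn.trans ?_) hc
  rw [← mul_div_assoc]
  have := hΦ n
  have := hΦ (2 * M m k)
  have := hΦ_mono _ _ (by omega) hk
  gcongr

/-! ### Divergence of the series. -/

/-- Each of the `N` coefficients in the block controls a triple of consecutive means. Summing over
the block gives three shifted sums, each at most the tail; hence the factor `3`. -/
theorem le_tail_of_coeff {m : ℕ → ℕ} (hm : ∀ k, 2 ≤ m k) {p : ℝ} (hp : 0 < p)
    (f : ℕ → G m → ℂ) {Φ : ℕ → ℝ} (hΦ_mono : ∀ a b, 0 < a → a ≤ b → Φ a ≤ Φ b)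
    {N : ℕ} (hN : 2 ≤ N) {t : ℝ} (ht : 0 < t)
    (hc : ∀ i, N ≤ i → i < 2 * N → 16 * N * t ≤ ‖coeff f i‖) :
    N * (ENNReal.ofReal (t ^ p) / ENNReal.ofReal (Φ (2 * N))) ≤
      3 * ∑' i, weakNorm p (fejer f (i + (N - 2) + 1)) ^ p
        / ENNReal.ofReal (Φ (i + (N - 2) + 1)) := by
  set v : ℕ → ENNReal := fun i => weakNorm p (fejer f (i + (N - 2) + 1)) ^ p
        / ENNReal.ofReal (Φ (i + (N - 2) + 1)) with hv
  have htail : ∀ s, ∑ i ∈ Finset.range N, v (i + s) ≤ ∑' i, v i := fun s =>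
    (ENNReal.sum_le_tsum _).trans
      (ENNReal.tsum_comp_le_tsum_of_injective (add_left_injective s) v)
  calc N * (ENNReal.ofReal (t ^ p) / ENNReal.ofReal (Φ (2 * N)))
      = ∑ i ∈ Finset.range N, ENNReal.ofReal (t ^ p) / ENNReal.ofReal (Φ (2 * N)) := by simp
    _ ≤ ∑ i ∈ Finset.range N, (v i + v (i + 1) + v (i + 2)) := by
      refine Finset.sum_le_sum fun i hi => ?_
      rw [Finset.mem_range] at hi
      -- The coefficient has index `i + N`, and the means have indices from `N - 1` to `2 N`, so
      -- `Φ(2 N)` dominates every weight involved. The bound `2 N` turns `8` into `16`.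
      have h := le_sum_three_weakNorm hm hp f (k := i + (N - 2)) (N := 2 * N) (by omega) ht (by
        refine le_trans (le_of_eq ?_) (hc _ (by omega) (by omega))
        push_cast; ring)
      refine (ENNReal.div_le_div_right h _).trans ?_
      rw [ENNReal.add_div, ENNReal.add_div]
      have hle : ∀ s ≤ 2, weakNorm p (fejer f (i + (N - 2) + (s + 1))) ^ p
          / ENNReal.ofReal (Φ (2 * N)) ≤ v (i + s) := by
        intro s hs
        have e : i + s + (N - 2) + 1 = i + (N - 2) + (s + 1) := by omega
        simp only [hv, e]
        exact ENNReal.div_le_div_left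
          (ENNReal.ofReal_le_ofReal (hΦ_mono _ _ (by omega) (by omega))) _
      exact add_le_add (add_le_add (hle 0 (by omega)) (hle 1 (by omega))) (hle 2 le_rfl)
    _ ≤ ∑' i, v i + ∑' i, v i + ∑' i, v i := by
      rw [Finset.sum_add_distrib, Finset.sum_add_distrib]
      exact add_le_add (add_le_add (htail 0) (htail 1)) (htail 2)
    _ = 3 * ∑' i, v i := by ring

/-- If the sum were finite, its tails would tend to zero; but for infinitely many `k` three times
the tail starting at index `M_k - 1` is at least `(1/16)^p`. -/
theorem tsum_eq_top_of_frequently {m : ℕ → ℕ} (hm : ∀ k, 2 ≤ m k) {p : ℝ} (hp : 0 < p)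
    {Φ : ℕ → ℝ} (hΦ : ∀ n, 0 < Φ n) (hΦ_mono : ∀ a b, 0 < a → a ≤ b → Φ a ≤ Φ b) {w : ℕ → ℝ}
    (hw : ∀ k, 0 ≤ w k)
    (hfreq : ∃ᶠ k in atTop, 1 ≤ w k * ((M m k : ℝ) ^ (2 - 2 * p) / Φ (2 * M m k))) :
    ∑' n : ℕ, weakNorm p (fejer (bumpSeries m fun k => (w k * M m k) ^ (1 / p)) (n + 1)) ^ p
      / ENNReal.ofReal (Φ (n + 1)) = ⊤ := by
  by_contra hne
  set f := bumpSeries m fun k => (w k * M m k) ^ (1 / p) with hf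
  have htend := ENNReal.tendsto_sum_nat_add _ hne
  have hMtend : Tendsto (fun k => M m k - 2) atTop atTop :=
    (tendsto_sub_atTop_nat 2).comp
      (tendsto_atTop_mono (fun k => (lt_M hm k).le) tendsto_id)
  have hlim := ENNReal.Tendsto.const_mul (a := 3) (htend.comp hMtend) (.inr (by simp))
  rw [mul_zero] at hlim
  have hc : (0 : ENNReal) < ENNReal.ofReal ((1 / 16) ^ p) := by
    rw [ENNReal.ofReal_pos]; positivity
  -- Requiring `k ≥ 1` ensures `M_k ≥ 2`.
  obtain ⟨k, hk1, hk2, hk3⟩ :=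
    (hfreq.and_eventually ((hlim.eventually_lt_const hc).and (eventually_ge_atTop 1))).exists
  refine hk2.not_ge ?_
  have hMk := lt_M hm k
  have hM : (0 : ℝ) < M m k := by exact_mod_cast M_pos hm k
  have hΦk := hΦ (2 * M m k)
  have hwk : 0 < w k := by
    refine (hw k).lt_of_ne fun h => ?_
    rw [← h, zero_mul] at hk1
    linarith
  -- The largest height allowed by `le_tail_of_coeff` with `N = M_k`: the coefficient `a_k / M_k`
  -- divided by `16 M_k`.
  let t : ℝ := (w k * M m k) ^ (1 / p) / (16 * M m k ^ 2)
  have ht : 0 < t := by positivity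
  refine le_trans ?_ (le_tail_of_coeff hm hp f hΦ_mono (by omega) ht fun i hi hi' => ?_)
  · rw [← ENNReal.ofReal_div_of_pos hΦk, ← ENNReal.ofReal_natCast, ← ENNReal.ofReal_mul hM.le]
    refine ENNReal.ofReal_le_ofReal ?_
    have htp : t ^ p = w k * M m k * ((1 / 16) ^ p * (M m k : ℝ) ^ (-(2 * p))) := by
      have e : t = (w k * M m k) ^ (1 / p) * (1 / 16 * (M m k : ℝ) ^ (-2 : ℝ)) := by
        rw [Real.rpow_neg hM.le, Real.rpow_ofNat]
        simp only [t]
        field_simp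
      rw [e, Real.mul_rpow (x := (w k * M m k) ^ (1 / p)) (by positivity) (by positivity),
        Real.mul_rpow (x := 1 / 16) (by positivity) (by positivity), ← Real.rpow_mul (by positivity),
        one_div_mul_cancel hp.ne', Real.rpow_one, ← Real.rpow_mul hM.le, neg_mul]
    have hMp : (M m k : ℝ) ^ (2 - 2 * p) = M m k * M m k * (M m k : ℝ) ^ (-(2 * p)) := by
      rw [sub_eq_add_neg, Real.rpow_add hM, Real.rpow_ofNat, sq]
    calc ((1 : ℝ) / 16) ^ p = (1 / 16) ^ p * 1 := (mul_one _).symm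
      _ ≤ (1 / 16) ^ p * (w k * ((M m k : ℝ) ^ (2 - 2 * p) / Φ (2 * M m k))) := by gcongr
      _ = _ := by rw [htp, hMp]; ring
  · rw [hf, coeff_bumpSeries hm _ hi hi', norm_div, Complex.norm_natCast, Complex.norm_real,
      Real.norm_of_nonneg (by positivity)]
    simp only [t]
    refine le_of_eq ?_
    field_simp

end Vilenkin

open Vilenkin in
theorem theorem2 (m : ℕ → ℕ) (hm : ∀ k, 2 ≤ m k) (hm_bdd : BddAbove (Set.range m))
    (p : ℝ) (hp_pos : 0 < p) (hp_lt : p < 1 / 2)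
    (Φ : ℕ+ → ℝ) (hΦ_one : ∀ n, 1 ≤ Φ n) (hΦ_mono : Monotone Φ)
    (hΦ_top : Filter.Tendsto Φ Filter.atTop Filter.atTop)
    (hΦ_limsup : Filter.limsup
      (fun n : ℕ+ => ((((n : ℕ) : ℝ) ^ (2 - 2 * p) / Φ n : ℝ) : EReal)) Filter.atTop = ⊤) :
    ∃ f : ℕ → Vilenkin.G m → ℂ, Vilenkin.MemHardy p f ∧
      ∑' k : ℕ+, Vilenkin.weakNorm p (Vilenkin.fejer f k) ^ p / ENNReal.ofReal (Φ k) = ⊤ := by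
  -- `Ψ 0` is `Φ 1`, a default value that does not enter the series.
  let Ψ : ℕ → ℝ := fun n => Φ n.toPNat'
  have hΨ : ∀ n : ℕ+, Ψ n = Φ n := fun n => by simp [Ψ]
  have hΨ_pos : ∀ n, 0 < Ψ n := fun n => one_pos.trans_le (hΦ_one _)
  have hΨ_mono : ∀ a b, 0 < a → a ≤ b → Ψ a ≤ Ψ b := fun a b ha hab => hΦ_mono <| by
    rw [← PNat.coe_le_coe, Nat.toPNat'_coe, Nat.toPNat'_coe, if_pos ha, if_pos (by omega)]
    exact hab
  have hfreq : ∀ C : ℝ, ∃ᶠ n : ℕ in Filter.atTop, C ≤ (n : ℝ) ^ (2 - 2 * p) / Ψ n := by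
    intro C
    have h := Filter.frequently_lt_of_lt_limsup (by isBoundedDefault)
      (hΦ_limsup ▸ EReal.coe_lt_top C)
    have ht : Filter.Tendsto (fun n : ℕ+ => (n : ℕ)) Filter.atTop Filter.atTop :=
      Filter.tendsto_atTop.2 fun b => (Filter.eventually_ge_atTop b.succPNat).mono fun n hn => by
        have := PNat.coe_le_coe _ _ |>.2 hn
        simp at this
        omega
    refine ht.frequently (h.mono fun n hn => ?_)
    rw [hΨ]
    exact (EReal.coe_lt_coe_iff.1 hn).le
  obtain ⟨w, hw, hsum, hw_freq⟩ := exists_summable_frequently_one_le_mul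
    (frequently_le_M_rpow_div hm hm_bdd (by linarith) hΨ_pos hΨ_mono hfreq)
  refine ⟨_, memHardy_bumpSeries hm hp_pos (by linarith) hw hsum, ?_⟩
  have h := tsum_eq_top_of_frequently hm hp_pos hΨ_pos hΨ_mono hw hw_freq
  rw [← tsum_pnat_eq_tsum_succ (f := fun n => weakNorm p (fejer (bumpSeries m fun k =>
    (w k * M m k) ^ (1 / p)) n) ^ p / ENNReal.ofReal (Ψ n))] at h
  simpa only [hΨ] using h
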